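/- Let $r\ge 2$ be an integer and put $\alpha=\frac{r+1}{2r}$. There is $n_0=n_0(r)$ such that the following holds for every integer $n\ge n_0$ and every real $b$ with $1\le b\le 2^{-10}r^{-2}n$. Let $G_\alpha$ be a graph on $n$ vertices with minimum degree at least $\alpha n$, and let $\chi:E(G_\alpha)\to[r]$ be an $r$-colouring of its edges (not necessarily proper). The colour bias of a Hamilton cycle $H$ of $G_\alpha$ is $\max_{c\in[r]}|\{e\in E(H):\chi(e)=c\}|-\frac nr$. If every Hamilton cycle of $G_\alpha$ has colour bias at most $b$, then there exist a set $U\subseteq V(G_\alpha)$ with $|U|=\lceil\alpha n\rceil$ and a colour $c^*\in[r]$ such that every matching $M$ in the induced subgraph $G_\alpha[U]$ that has no edge of colour $c^*$ satisfies $e(M)<2^9rb$. -/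

import Mathlib

/-- The critical minimum degree density `(r + 1) / (2 r)`. -/
noncomputable def criticalDensity (r : ℕ) : ℝ := ((r : ℝ) + 1) / (2 * (r : ℝ))

/-- For an edge colouring `χ` of `G` with `r` colours (not necessarily proper), the number of
distinct edges traversed by the walk `p` that have colour `c`. -/
noncomputable def colourCount {V : Type*} {G : SimpleGraph V} {r : ℕ} (χ : G.EdgeLabeling (Fin r))
    {v : V} (p : G.Walk v v) (c : Fin r) : ℕ :=
  {e : G.edgeSet | (e : Sym2 V) ∈ p.edges ∧ χ e = c}.ncard

/-- The colour bias of a Hamilton cycle `p` of `G`: the number `t` such that the most frequent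
colour on `p` occurs on exactly `n / r + t` edges of `p`, where `n` is the number of vertices. -/
noncomputable def colourBias {V : Type*} [Fintype V] {G : SimpleGraph V} {r : ℕ}
    (χ : G.EdgeLabeling (Fin r)) {v : V} (p : G.Walk v v) : ℝ :=
  (⨆ c : Fin r, (colourCount χ p c : ℝ)) - (Fintype.card V : ℝ) / (r : ℝ)

/-- `M` is a matching of `G` all of whose edges lie inside `U`, i.e. a matching of the induced
graph `G[U]`. -/
def IsMatchingInside {V : Type*} {G : SimpleGraph V} (M : G.Subgraph) (U : Finset V) : Prop :=
  M.IsMatching ∧ M.verts ⊆ (U : Set V)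

/-- No edge of the subgraph `M` has colour `c`. -/
def AvoidsColour {V : Type*} {G : SimpleGraph V} {r : ℕ} (χ : G.EdgeLabeling (Fin r))
    (M : G.Subgraph) (c : Fin r) : Prop :=
  ∀ e : G.edgeSet, (e : Sym2 V) ∈ M.edgeSet → χ e ≠ c

/-!
A vertex `u` can be inserted into an edge `xy` of a cycle if `u x y` is a triangle. This changes the
vector of colour counts of the cycle by `e(ux) + e(uy) - e(xy)`, where `e` of an edge is the unit
vector of its colour (`insertionVector`). A bowtie consists of two triangles `u x y` and `u p q`
meeting only in `u`; it is unbalanced if its two insertion vectors differ.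

*Few disjoint unbalanced bowties.* The degree condition says `2 δ ≥ n + n / r`, so by Pósa's theorem
(`exists_hamilton_list`) there is a Hamilton cycle through the outer edges `xy` and `pq` of any `k`
disjoint bowties on the vertices other than the `k` centres, provided that `3 k ≤ n / r`. Each
centre can be inserted into either of its two edges independently, giving `2 ^ k` Hamilton cycles of
`G`. Bias at most `b` confines the number of edges with colour in a set `S` to an interval of length
`r b`; averaging over `S` (`card_le_of_all_choices`) shows `k ≤ 2 r b`
(`length_le_of_disjoint_unbalanced`). Hence a set `X` of at most `10 r b` vertices meets all
unbalanced bowties.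

*Structure off `X`.* Any two vertices have a common neighbour outside `X`, even after a few more
vertices are excluded. So the insertion vector of a triangle outside `X` depends only on the
inserted vertex, say `f u` for `u`, and adding the vectors of two vertices of a triangle gives
`f u + f x = 2 e(ux)` for each edge `ux`. Hence all `f u` agree modulo 2. Their coordinate sum is
`1`, so some colour `c` has `f u c` odd for every `u`. The set `W` of vertices with `f u c < 0` is
independent, and an edge `ux` avoiding `W` has `f u c + f x c ≥ 2`, hence colour `c`
(`exists_independent_set`). As `W` is independent, its complement has at least `δ` vertices and
contains a set `U` of the required size; every edge inside `U` of a colour other than `c` meets `X`,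
so a matching of such edges has at most `|X| ≤ 10 r b` edges.
-/

namespace ColourBias

/-! ### Closed vertex sequences and their edges -/

/-- The edges joining consecutive vertices of a list. -/
def pathEdges {V : Type*} : List V → Multiset (Sym2 V)
  | [] => 0
  | [_] => 0
  | a :: b :: l => s(a, b) ::ₘ pathEdges (b :: l)

/-- The edges joining cyclically consecutive vertices of a list, including the one from the last
vertex back to the first. -/
def cycleEdges {V : Type*} : List V → Multiset (Sym2 V)
  | [] => 0
  | a :: l => pathEdges (a :: (l ++ [a]))

section Lists

variable {V : Type*}

lemma pathEdges_append (l m : List V) (a : V) :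
    pathEdges (l ++ a :: m) = pathEdges (l ++ [a]) + pathEdges (a :: m) := by
  induction l with
  | nil => simp [pathEdges]
  | cons x t ih =>
    cases t with
    | nil => simp [pathEdges]
    | cons y t => simpa [pathEdges] using ih

lemma pathEdges_append_cons (l m : List V) (a b : V) :
    pathEdges (l ++ a :: b :: m) =
      s(a, b) ::ₘ (pathEdges (l ++ [a]) + pathEdges (b :: m)) := by
  rw [pathEdges_append, pathEdges, Multiset.add_cons]

lemma pathEdges_reverse (l : List V) : pathEdges l.reverse = pathEdges l := by
  induction l with
  | nil => rfl
  | cons x t ih =>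
    cases t with
    | nil => rfl
    | cons y t =>
      have h := pathEdges_append t.reverse [x] y
      simp only [List.reverse_cons, List.append_assoc, List.singleton_append] at h ih ⊢
      rw [h, ih]
      rw [add_comm]
      simp [pathEdges, Sym2.eq_swap]

lemma cycleEdges_append_comm (l m : List V) : cycleEdges (l ++ m) = cycleEdges (m ++ l) := by
  cases l with
  | nil => simp
  | cons a l =>
    cases m with
    | nil => simp
    | cons b m =>
      have h₁ := pathEdges_append (a :: l) (m ++ [a]) b
      have h₂ := pathEdges_append (b :: m) (l ++ [b]) a
      simp only [cycleEdges, List.cons_append, List.append_assoc] at h₁ h₂ ⊢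
      rw [h₁, h₂, add_comm]

lemma cycleEdges_eq (a z : V) (l : List V) :
    cycleEdges (a :: (l ++ [z])) = s(z, a) ::ₘ pathEdges (a :: (l ++ [z])) := by
  have h := pathEdges_append (a :: l) [a] z
  simp only [cycleEdges, List.cons_append, List.append_assoc, List.nil_append] at h ⊢
  rw [h, add_comm]
  simp [pathEdges]

lemma mem_of_mem_pathEdges {l : List V} {e : Sym2 V} (he : e ∈ pathEdges l) {v : V} (hv : v ∈ e) :
    v ∈ l := by
  induction l with
  | nil => simp [pathEdges] at he
  | cons x t ih =>
    cases t with
    | nil => simp [pathEdges] at he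
    | cons y t =>
      rcases Multiset.mem_cons.1 he with rfl | he
      · rcases Sym2.mem_iff.1 hv with rfl | rfl <;> simp
      · exact List.mem_cons_of_mem _ (ih he)

lemma nodup_pathEdges {l : List V} (hl : l.Nodup) : (pathEdges l).Nodup := by
  induction l with
  | nil => simp [pathEdges]
  | cons x t ih =>
    cases t with
    | nil => simp [pathEdges]
    | cons y t =>
      rw [pathEdges, Multiset.nodup_cons]
      exact ⟨fun h => (List.nodup_cons.1 hl).1 (mem_of_mem_pathEdges h (Sym2.mem_mk_left x y)),
        ih (List.nodup_cons.1 hl).2⟩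

lemma exists_split_of_mem_pathEdges {l : List V} {e : Sym2 V} (he : e ∈ pathEdges l) :
    ∃ l₁ a b l₂, l = l₁ ++ a :: b :: l₂ ∧ e = s(a, b) := by
  induction l with
  | nil => simp [pathEdges] at he
  | cons x t ih =>
    cases t with
    | nil => simp [pathEdges] at he
    | cons y t =>
      rcases Multiset.mem_cons.1 he with rfl | he
      · exact ⟨[], x, y, t, rfl, rfl⟩
      · obtain ⟨l₁, a, b, l₂, h, rfl⟩ := ih he
        exact ⟨x :: l₁, a, b, l₂, by rw [h]; rfl, rfl⟩

/-- Any edge of a closed sequence can be made its closing edge by a rotation. -/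
lemma exists_rotation {l : List V} (hl : 2 ≤ l.length) {e : Sym2 V} (he : e ∈ cycleEdges l) :
    ∃ a m z, (a :: (m ++ [z])).Perm l ∧ cycleEdges (a :: (m ++ [z])) = cycleEdges l ∧
      e = s(z, a) := by
  cases l with
  | nil => simp at hl
  | cons x t =>
    obtain ⟨l₁, p, q, l₂, h, rfl⟩ := exists_split_of_mem_pathEdges he
    rcases List.eq_nil_or_concat l₂ with rfl | ⟨l₃, y, rfl⟩
    · have h' : (x :: t) ++ [x] = (l₁ ++ [p]) ++ [q] := by simpa using h
      obtain ⟨h₁, h₂⟩ := List.append_inj' h' rfl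
      obtain rfl : x = q := by simpa using h₂
      cases l₁ with
      | nil =>
        simp only [List.nil_append, List.cons.injEq] at h₁
        simp [h₁.2] at hl
      | cons c l₁ =>
        simp only [List.cons_append, List.cons.injEq] at h₁
        obtain ⟨rfl, rfl⟩ := h₁
        exact ⟨x, l₁, p, List.Perm.refl _, rfl, rfl⟩
    · have h' : (x :: t) ++ [x] = (l₁ ++ p :: q :: l₃) ++ [y] := by simpa using h
      obtain ⟨h₁, -⟩ := List.append_inj' h' rfl
      have h₁' : x :: t = (l₁ ++ [p]) ++ q :: l₃ := by simpa using h₁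
      have key : q :: ((l₃ ++ l₁) ++ [p]) = (q :: l₃) ++ (l₁ ++ [p]) := by simp
      refine ⟨q, l₃ ++ l₁, p, ?_, ?_, rfl⟩
      · rw [h₁', key]; exact List.perm_append_comm
      · rw [h₁', key, cycleEdges_append_comm]

/-- A vertex can be inserted into any edge of a closed sequence. -/
lemma exists_insert {l : List V} (hl : 2 ≤ l.length) (u x y : V) (R : Multiset (Sym2 V))
    (h : cycleEdges l = s(x, y) ::ₘ R) :
    ∃ l' : List V, l'.Perm (u :: l) ∧ cycleEdges l' = s(u, x) ::ₘ s(u, y) ::ₘ R := by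
  obtain ⟨a, m, z, hp, hc, he⟩ := exists_rotation hl (h ▸ Multiset.mem_cons_self _ _)
  refine ⟨u :: (a :: (m ++ [z])), hp.cons u, ?_⟩
  have h₁ := cycleEdges_eq u z (a :: m)
  have h₂ := cycleEdges_eq a z m
  rw [hc, h, he, Multiset.cons_inj_right] at h₂
  simp only [List.cons_append] at h₁
  rw [h₁, pathEdges, ← h₂]
  rcases Sym2.eq_iff.1 he with ⟨rfl, rfl⟩ | ⟨rfl, rfl⟩
  · rw [Sym2.eq_swap]
  · rw [Multiset.cons_swap, Sym2.eq_swap (a := y)]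

/-- Several vertices are inserted at the same time into distinct edges of a closed sequence;
`(u, x, y)` in the list `I` stands for the insertion of `u` into the edge `xy`. -/
lemma exists_insert_list (I : List (V × V × V)) {l : List V} (hl : 2 ≤ l.length)
    (R : Multiset (Sym2 V))
    (h : cycleEdges l = (I.map fun t => s(t.2.1, t.2.2) : Multiset (Sym2 V)) + R) :
    ∃ l' : List V, l'.Perm (I.map (·.1) ++ l) ∧
      cycleEdges l' = (I.map fun t => s(t.1, t.2.1) : Multiset (Sym2 V)) +
        (I.map fun t => s(t.1, t.2.2) : Multiset (Sym2 V)) + R := by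
  induction I generalizing l R with
  | nil => exact ⟨l, by simp, by simpa using h⟩
  | cons t I ih =>
    obtain ⟨u, x, y⟩ := t
    simp only [List.map_cons, ← Multiset.cons_coe, Multiset.cons_add] at h ⊢
    obtain ⟨l₁, hp₁, hc₁⟩ := exists_insert hl u x y _ h
    obtain ⟨l', hp, hc⟩ := ih (l := l₁) (by rw [hp₁.length_eq]; simp; omega)
      (s(u, x) ::ₘ s(u, y) ::ₘ R) (by rw [hc₁]; simp [Multiset.add_cons])
    refine ⟨l', hp.trans ?_, by rw [hc]; simp only [Multiset.add_cons, Multiset.cons_add]⟩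
    exact (hp₁.append_left _).trans List.perm_middle

lemma card_pathEdges_cons (a : V) (l : List V) : (pathEdges (a :: l)).card = l.length := by
  induction l generalizing a with
  | nil => rfl
  | cons b l ih => simp [pathEdges, ih]

lemma card_cycleEdges (l : List V) : (cycleEdges l).card = l.length := by
  cases l with
  | nil => rfl
  | cons a l => simp [cycleEdges, card_pathEdges_cons]

end Lists

/-! ### Hamilton cycles through prescribed edges -/

section Hamilton

variable {V : Type*} [DecidableEq V]

/-- Crossing pairs along a path: if every consecutive pair `(x, y)` with `P y` and `Q x` is an edge
in `F`, then the number of non-initial vertices with `P` plus the number of non-final vertices with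
`Q` is at most the number of edges of the path plus the number of them that lie in `F`. -/
lemma countP_tail_add_countP_dropLast_le (P Q : V → Prop) [DecidablePred P] [DecidablePred Q]
    (F : Multiset (Sym2 V)) (l : List V)
    (h : ∀ l₁ x y l₂, l = l₁ ++ x :: y :: l₂ → P y → Q x → s(x, y) ∈ F) :
    l.tail.countP P + l.dropLast.countP Q
      ≤ (l.length - 1) + (pathEdges l).countP (· ∈ F) := by
  induction l with
  | nil => simp
  | cons x t ih =>
    cases t with
    | nil => simp [pathEdges]
    | cons y t =>
      have ih' := ih fun l₁ a b l₂ e => h (x :: l₁) a b l₂ (by rw [e]; rfl)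
      have h₀ := h [] x y t rfl
      simp only [List.tail_cons, List.dropLast_cons_cons, List.countP_cons, pathEdges,
        Multiset.countP_cons, List.length_cons, decide_eq_true_eq] at ih' ⊢
      by_cases hP : P y <;> by_cases hQ : Q x <;> simp only [hP, hQ, if_true, if_false]
      · rw [if_pos (h₀ hP hQ)]; omega
      all_goals omega

/-- A theorem of Pósa, by the closure argument of Bondy and Chvátal: if the degrees within the vertex set of `l`
are large, the closed sequence `l` can be rearranged into a Hamilton cycle of that vertex set
without losing the edges in `F`. The proof removes the non-edges of the sequence one by one: a
non-edge is rotated to the closing position, and the degree condition yields an edge outside `F`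
at which the sequence can be cut and reversed. -/
theorem exists_hamilton_list (G : SimpleGraph V) [DecidableRel G.Adj] (F : Multiset (Sym2 V))
    (hF : ∀ e ∈ F, e ∈ G.edgeSet) (l : List V) (hl : l.Nodup) (hlen : 2 ≤ l.length)
    (hFl : F ≤ cycleEdges l)
    (hdeg : ∀ v ∈ l, l.length + F.card ≤ 2 * l.countP (G.Adj v)) :
    ∃ l' : List V, l'.Perm l ∧ F ≤ cycleEdges l' ∧ ∀ e ∈ cycleEdges l', e ∈ G.edgeSet := by
  induction hk : (cycleEdges l).countP (· ∉ G.edgeSet) using Nat.strong_induction_on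
    generalizing l with
  | _ k ih =>
  by_cases hgood : ∀ e ∈ cycleEdges l, e ∈ G.edgeSet
  · exact ⟨l, List.Perm.refl _, hFl, hgood⟩
  push Not at hgood
  obtain ⟨e, he, heG⟩ := hgood
  obtain ⟨a, m, z, hp, hc, rfl⟩ := exists_rotation hlen he
  have haz : ¬ G.Adj z a := heG
  have hnd : (a :: (m ++ [z])).Nodup := hp.nodup_iff.2 hl
  set w := a :: (m ++ [z]) with hw
  have hcw := cycleEdges_eq a z m
  rw [← hw] at hcw
  have hFp : F ≤ pathEdges w := by
    rw [← hc, hcw] at hFl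
    exact (Multiset.le_cons_of_notMem fun h => heG (hF _ h)).1 hFl
  -- The cutting edge: `x` and `y` are consecutive, with `y` adjacent to `a` and `x` to `z`.
  obtain ⟨l₁, x, y, l₂, hs, hay, hzx, hxy⟩ : ∃ l₁ x y l₂, w = l₁ ++ x :: y :: l₂ ∧
      G.Adj a y ∧ G.Adj z x ∧ s(x, y) ∉ F := by
    by_contra hno
    push Not at hno
    have hcount := countP_tail_add_countP_dropLast_le (G.Adj a) (G.Adj z) F w
      fun l₁ x y l₂ h₁ h₂ h₃ => hno l₁ x y l₂ h₁ h₂ h₃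
    have hFc : (pathEdges w).countP (· ∈ F) ≤ F.card := by
      rw [Multiset.countP_eq_card_filter]
      refine Multiset.card_le_card ?_
      rw [Multiset.le_iff_subset ((nodup_pathEdges hnd).filter _)]
      exact fun e he => (Multiset.mem_filter.1 he).2
    have h₁ : w.countP (G.Adj a) = w.tail.countP (G.Adj a) := by simp [hw]
    have h₂ : w.countP (G.Adj z) = w.dropLast.countP (G.Adj z) := by
      have : w.dropLast = a :: m := by rw [hw, ← List.cons_append, List.dropLast_concat]
      rw [this, hw, ← List.cons_append, List.countP_append]
      simp
    have hda := hdeg a (hp.mem_iff.1 (by simp [hw]))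
    have hdz := hdeg z (hp.mem_iff.1 (by simp [hw]))
    rw [← hp.countP_eq] at hda hdz
    have := hp.length_eq
    omega
  obtain ⟨l₃, hl₃⟩ : ∃ l₃, l₁ ++ [x] = a :: l₃ := by
    cases l₁ with
    | nil =>
      simp only [hw, List.nil_append, List.cons.injEq] at hs
      exact ⟨[], by simp [hs.1]⟩
    | cons c l₁ =>
      simp only [hw, List.cons_append, List.cons.injEq] at hs
      exact ⟨l₁ ++ [x], by simp [hs.1]⟩
  obtain ⟨l₄, hl₄⟩ : ∃ l₄, y :: l₂ = l₄ ++ [z] := by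
    have hs' : (a :: m) ++ [z] = (l₁ ++ [x]) ++ y :: l₂ := by simpa [hw] using hs
    rcases List.eq_nil_or_concat (y :: l₂) with h | ⟨l₄, q, h⟩
    · simp at h
    · rw [List.concat_eq_append] at h
      rw [h, ← List.append_assoc] at hs'
      obtain ⟨-, h₂⟩ := List.append_inj' hs' rfl
      exact ⟨l₄, by rw [h, h₂]⟩
  have hpw : pathEdges w = s(x, y) ::ₘ (pathEdges (l₁ ++ [x]) + pathEdges (y :: l₂)) := by
    rw [hs, pathEdges_append_cons]
  have hrev : z :: l₄.reverse = l₂.reverse ++ [y] := by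
    simpa using (congrArg List.reverse hl₄).symm
  have hw' : a :: ((l₃ ++ l₂.reverse) ++ [y]) = l₁ ++ x :: z :: l₄.reverse := by
    rw [hrev, List.append_assoc, ← List.cons_append, ← hl₃]
    simp
  set w' := a :: ((l₃ ++ l₂.reverse) ++ [y]) with hw'_def
  have hcw' : cycleEdges w' =
      s(y, a) ::ₘ s(x, z) ::ₘ (pathEdges (l₁ ++ [x]) + pathEdges (y :: l₂)) := by
    rw [hw'_def, cycleEdges_eq, ← hw'_def, hw', pathEdges_append_cons, hl₄,
      ← pathEdges_reverse (l₄ ++ [z])]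
    simp
  have hperm : w'.Perm l := by
    refine List.Perm.trans ?_ hp
    have : z :: l₄.reverse = (y :: l₂).reverse := by rw [hl₄]; simp
    rw [hw', hs, this]
    exact ((List.reverse_perm _).cons x).append_left l₁
  have hFw' : F ≤ cycleEdges w' := by
    rw [hpw] at hFp
    rw [hcw']
    exact ((Multiset.le_cons_of_notMem hxy).1 hFp).trans
      ((Multiset.le_cons_self _ _).trans (Multiset.le_cons_self _ _))
  have hlt : (cycleEdges w').countP (· ∉ G.edgeSet) < k := by
    have hya : G.Adj y a := hay.symm
    have hxz : G.Adj x z := hzx.symm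
    rw [← hk, ← hc, hcw, hcw', hpw]
    simp only [Multiset.countP_cons, SimpleGraph.mem_edgeSet, hya, hxz, haz, not_true, not_false_iff,
      if_true, if_false]
    omega
  obtain ⟨l', hl'p, hl'F, hl'G⟩ := ih _ hlt w' (hperm.nodup_iff.2 hl)
    (by rw [hperm.length_eq]; exact hlen) hFw'
    (fun v hv => by
      rw [hperm.length_eq, hperm.countP_eq]; exact hdeg v (hperm.mem_iff.1 hv)) rfl
  exact ⟨l', hl'p.trans hperm, hl'F, hl'G⟩

/-- A closed sequence through all vertices whose edges lie in `G` is a Hamilton cycle of `G`. -/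
lemma exists_isHamiltonianCycle [Fintype V] (G : SimpleGraph V) (l : List V) (hl : l.Nodup)
    (huniv : ∀ v, v ∈ l) (hlen : 3 ≤ l.length) (hG : ∀ e ∈ cycleEdges l, e ∈ G.edgeSet) :
    ∃ (v : V) (p : G.Walk v v), p.IsHamiltonianCycle ∧
      (p.edges : Multiset (Sym2 V)) = cycleEdges l := by
  have hwalk : ∀ (m : List V) (a z : V), (∀ e ∈ pathEdges (a :: (m ++ [z])), e ∈ G.edgeSet) →
      ∃ p : G.Walk a z, p.support = a :: (m ++ [z]) ∧
        (p.edges : Multiset (Sym2 V)) = pathEdges (a :: (m ++ [z])) := by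
    intro m
    induction m with
    | nil =>
      intro a z h
      have haz : G.Adj a z := h s(a, z) (by simp [pathEdges])
      exact ⟨haz.toWalk, by simp, by simp [pathEdges]⟩
    | cons b m ih =>
      intro a z h
      have hab : G.Adj a b := h s(a, b) (by simp [pathEdges])
      obtain ⟨p, hp₁, hp₂⟩ := ih b z fun e he => h e (by
        rw [List.cons_append, pathEdges]; exact Multiset.mem_cons_of_mem he)
      refine ⟨.cons hab p, by simp [hp₁], ?_⟩
      rw [SimpleGraph.Walk.edges_cons, ← Multiset.cons_coe, hp₂, List.cons_append, pathEdges]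
  obtain ⟨a, x, m, z, rfl⟩ : ∃ a x m z, l = a :: ((x :: m) ++ [z]) := by
    match l, hlen with
    | a :: x :: y :: t, _ =>
      rcases List.eq_nil_or_concat (y :: t) with h | ⟨m, z, h⟩
      · simp at h
      · exact ⟨a, x, m, z, by rw [h]; simp⟩
  have hce := cycleEdges_eq a z (x :: m)
  rw [hce] at hG ⊢
  obtain ⟨p, hps, hpe⟩ := hwalk (x :: m) a z fun e he => hG e (Multiset.mem_cons_of_mem he)
  have hza : G.Adj z a := hG s(z, a) (Multiset.mem_cons_self _ _)
  have hcl : s(z, a) ∉ p.edges := by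
    rw [← Multiset.mem_coe, hpe, List.cons_append, pathEdges, Multiset.mem_cons, not_or]
    simp only [List.nodup_cons, List.cons_append, List.mem_cons, List.mem_append,
      not_or] at hl
    constructor
    · intro h
      rcases Sym2.eq_iff.1 h with ⟨rfl, -⟩ | ⟨rfl, -⟩
      · exact hl.1.2.2.1 rfl
      · exact hl.2.1.2.1 rfl
    · intro h
      have := mem_of_mem_pathEdges h (Sym2.mem_mk_right z a)
      simp only [List.mem_cons, List.mem_append] at this
      tauto
  refine ⟨z, .cons hza p, ?_, ?_⟩
  · rw [SimpleGraph.Walk.isHamiltonianCycle_iff_isCycle_and_length_eq,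
      SimpleGraph.Walk.cons_isCycle_iff]
    refine ⟨⟨(SimpleGraph.Walk.isPath_def p).2 (by rw [hps]; exact hl), hcl⟩, ?_⟩
    rw [SimpleGraph.Walk.length_cons, ← SimpleGraph.Walk.length_support, hps,
      ← List.toFinset_card_of_nodup hl, ← Finset.card_univ]
    congr 1
    ext v
    simpa only [List.mem_toFinset, Finset.mem_univ, iff_true] using huniv v
  · rw [SimpleGraph.Walk.edges_cons, ← Multiset.cons_coe, hpe]

end Hamilton

/-! ### Averaging over sets of colours -/

section Averaging

variable {r : ℕ}

/-- A nonzero integer vector has, on average over all sets `S` of coordinates, a partial sum over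
`S` of absolute value at least `1 / 2`: toggling a nonzero coordinate changes the partial sum. -/
lemma two_pow_le_sum_abs (d : Fin r → ℤ) (hd : d ≠ 0) :
    (2 : ℤ) ^ r ≤ 2 * ∑ S : Finset (Fin r), |∑ c ∈ S, d c| := by
  obtain ⟨c, hc⟩ := Function.ne_iff.1 hd
  have hinv : Function.Involutive fun S : Finset (Fin r) => symmDiff S {c} :=
    fun S => symmDiff_symmDiff_cancel_right _ _
  have h₁ : ∑ S : Finset (Fin r), |∑ c ∈ symmDiff S {c}, d c| =
      ∑ S : Finset (Fin r), |∑ c ∈ S, d c| :=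
    Equiv.sum_comp hinv.toPerm fun S : Finset (Fin r) => |∑ c ∈ S, d c|
  have h₂ : ∀ S : Finset (Fin r), 1 ≤ |∑ c ∈ S, d c| + |∑ c ∈ symmDiff S {c}, d c| := by
    intro S
    have h₃ : |∑ c ∈ S, d c - ∑ c ∈ symmDiff S {c}, d c| = |d c| := by
      by_cases hcS : c ∈ S
      · have : symmDiff S {c} = S.erase c := by
          ext x; by_cases hx : x = c <;> simp [Finset.mem_symmDiff, hx, hcS]
        rw [this, ← Finset.add_sum_erase S d hcS]
        simp
      · have : symmDiff S {c} = insert c S := by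
          ext x; by_cases hx : x = c <;> simp [Finset.mem_symmDiff, hx, hcS]
        rw [this, Finset.sum_insert hcS]
        simp
    have h₄ : 1 ≤ |d c| := Int.one_le_abs hc
    have h₅ := abs_sub (∑ c ∈ S, d c) (∑ c ∈ symmDiff S {c}, d c)
    omega
  calc (2 : ℤ) ^ r = ∑ _S : Finset (Fin r), (1 : ℤ) := by simp
    _ ≤ ∑ S : Finset (Fin r), (|∑ c ∈ S, d c| + |∑ c ∈ symmDiff S {c}, d c|) :=
      Finset.sum_le_sum fun S _ => h₂ S
    _ = 2 * ∑ S : Finset (Fin r), |∑ c ∈ S, d c| := by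
      rw [Finset.sum_add_distrib, h₁, two_mul]

/-- Suppose that each of the `2 ^ |B|` vectors obtained from `P` by adding, for each `t ∈ B`, either
`g t` or `h t`, has coordinate sum `n` and all coordinates at most `n / r + b`. If `g t ≠ h t` for
all `t ∈ B`, then `|B| ≤ 2 r b`: for every set `S` of coordinates the partial sum over `S` lies in
an interval of length `r b`, and two of the vectors have partial sums differing by
`∑ t ∈ B, |∑ c ∈ S, (g t c - h t c)|`. -/
lemma card_le_of_all_choices {β : Type*} (hr : 0 < r) (B : Finset β) (g h : β → Fin r → ℤ)
    (hgh : ∀ t ∈ B, g t ≠ h t) (P : Fin r → ℤ) (n b : ℝ)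
    (hsum : ∀ σ : β → Bool,
      ((∑ c, (P + ∑ t ∈ B, if σ t then g t else h t) c : ℤ) : ℝ) = n)
    (hle : ∀ (σ : β → Bool) (c : Fin r),
      (((P + ∑ t ∈ B, if σ t then g t else h t) c : ℤ) : ℝ) ≤ n / r + b) :
    (B.card : ℝ) ≤ 2 * r * b := by
  classical
  have hr' : (0 : ℝ) < r := by exact_mod_cast hr
  set N : (β → Bool) → Fin r → ℤ := fun σ => P + ∑ t ∈ B, if σ t then g t else h t with hN
  have hswing : ∀ S : Finset (Fin r),
      ((∑ t ∈ B, |∑ c ∈ S, (g t - h t) c| : ℤ) : ℝ) ≤ r * b := by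
    intro S
    set σ : β → Bool := fun t => decide (0 ≤ ∑ c ∈ S, (g t - h t) c) with hσ
    have hdiff : ∑ t ∈ B, |∑ c ∈ S, (g t - h t) c| =
        ∑ c ∈ S, N σ c - ∑ c ∈ S, N (fun t => !σ t) c := by
      rw [← Finset.sum_sub_distrib]
      have : ∀ c ∈ S, N σ c - N (fun t => !σ t) c =
          ∑ t ∈ B, if σ t then (g t - h t) c else -(g t - h t) c := by
        intro c _
        simp only [hN, Pi.add_apply, Finset.sum_apply, add_sub_add_left_eq_sub]
        rw [← Finset.sum_sub_distrib]
        refine Finset.sum_congr rfl fun t _ => ?_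
        by_cases h : σ t = true <;> simp [h]
      rw [Finset.sum_congr rfl this, Finset.sum_comm]
      refine Finset.sum_congr rfl fun t _ => ?_
      by_cases ht : 0 ≤ ∑ c ∈ S, (g t - h t) c
      · simp only [hσ, ht, decide_true, if_true]
        exact abs_of_nonneg ht
      · simp only [hσ, ht, decide_false, Bool.false_eq_true, if_false, Finset.sum_neg_distrib]
        exact abs_of_neg (not_le.1 ht)
    have hcompl : ∑ c ∈ S, N (fun t => !σ t) c =
        ∑ c, N (fun t => !σ t) c - ∑ c ∈ Sᶜ, N (fun t => !σ t) c := by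
      rw [← Finset.sum_add_sum_compl S]; ring
    have h₁ : ((∑ c ∈ S, N σ c : ℤ) : ℝ) ≤ S.card * (n / r + b) := by
      push_cast
      rw [← nsmul_eq_mul]
      exact Finset.sum_le_card_nsmul _ _ _ fun c _ => hle σ c
    have h₂ : ((∑ c ∈ Sᶜ, N (fun t => !σ t) c : ℤ) : ℝ) ≤ (Sᶜ).card * (n / r + b) := by
      push_cast
      rw [← nsmul_eq_mul]
      exact Finset.sum_le_card_nsmul _ _ _ fun c _ => hle (fun t => !σ t) c
    have h₃ : (S.card : ℝ) + (Sᶜ).card = r := by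
      have := Finset.card_add_card_compl S
      rw [Fintype.card_fin] at this
      exact_mod_cast this
    have h₄ := hsum fun t => !σ t
    have h₅ : (r : ℝ) * (n / r + b) = n + r * b := by field_simp
    rw [hdiff, hcompl]
    push_cast at h₁ h₂ h₄ ⊢
    have : (S.card : ℝ) * (n / r + b) + (Sᶜ).card * (n / r + b) = n + r * b := by
      rw [← h₅, ← h₃]; ring
    linarith
  have hlow : (B.card : ℤ) * 2 ^ r ≤
      2 * ∑ S : Finset (Fin r), ∑ t ∈ B, |∑ c ∈ S, (g t - h t) c| := by
    rw [Finset.sum_comm, Finset.mul_sum, ← nsmul_eq_mul]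
    exact Finset.card_nsmul_le_sum _ _ _ fun t ht =>
      two_pow_le_sum_abs (g t - h t) (sub_ne_zero.2 (hgh t ht))
  have hup : ((∑ S : Finset (Fin r), ∑ t ∈ B, |∑ c ∈ S, (g t - h t) c| : ℤ) : ℝ) ≤
      2 ^ r * (r * b) := by
    have := Finset.sum_le_card_nsmul (Finset.univ : Finset (Finset (Fin r))) _ _ fun S _ => hswing S
    rw [Finset.card_univ, Fintype.card_finset, Fintype.card_fin, nsmul_eq_mul] at this
    push_cast at this ⊢
    exact this
  have hlow' : (B.card : ℝ) * 2 ^ r ≤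
      2 * ((∑ S : Finset (Fin r), ∑ t ∈ B, |∑ c ∈ S, (g t - h t) c| : ℤ) : ℝ) := by
    exact_mod_cast hlow
  have h2 : (0 : ℝ) < 2 ^ r := by positivity
  refine le_of_mul_le_mul_right (a := (2 : ℝ) ^ r) ?_ h2
  linarith

end Averaging

/-! ### Bowties and insertion vectors -/

/-- Five vertices meant to form two triangles `u x y` and `u p q` sharing only the vertex `u`. -/
structure Bowtie (V : Type*) where
  /-- The centre. -/
  u : V
  /-- A vertex of the first triangle. -/
  x : V
  /-- A vertex of the first triangle. -/
  y : V
  /-- A vertex of the second triangle. -/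
  p : V
  /-- A vertex of the second triangle. -/
  q : V

section Bowties

variable {V : Type*} {r : ℕ}

/-- The vertices of a bowtie. -/
def Bowtie.verts (t : Bowtie V) : List V := [t.u, t.x, t.y, t.p, t.q]

/-- The six edges of the two triangles of the bowtie are present in `G`. Distinctness of the five
vertices is not part of this definition. -/
def Bowtie.IsIn (t : Bowtie V) (G : SimpleGraph V) : Prop :=
  (G.Adj t.u t.x ∧ G.Adj t.u t.y ∧ G.Adj t.x t.y) ∧ (G.Adj t.u t.p ∧ G.Adj t.u t.q ∧ G.Adj t.p t.q)

/-- The vector counting for each colour the edges of that colour in a multiset of edges. -/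
def profile (col : Sym2 V → Fin r) (E : Multiset (Sym2 V)) : Fin r → ℤ :=
  (E.map fun e => Pi.single (col e) (1 : ℤ)).sum

/-- The change of the colour profile of a cycle when the vertex `u` is inserted into its edge
`xy`. -/
def insertionVector (col : Sym2 V → Fin r) (u x y : V) : Fin r → ℤ :=
  Pi.single (col s(u, x)) 1 + Pi.single (col s(u, y)) 1 - Pi.single (col s(x, y)) 1

/-- A bowtie is unbalanced if inserting its centre into its two outer edges has different effects on
the colour profile. -/
def Bowtie.Unbalanced (t : Bowtie V) (col : Sym2 V → Fin r) : Prop :=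
  insertionVector col t.u t.x t.y ≠ insertionVector col t.u t.p t.q

lemma profile_add (col : Sym2 V → Fin r) (E E' : Multiset (Sym2 V)) :
    profile col (E + E') = profile col E + profile col E' := by
  simp [profile]

lemma profile_apply (col : Sym2 V → Fin r) (E : Multiset (Sym2 V)) (c : Fin r) :
    profile col E c = E.countP fun e => col e = c := by
  induction E using Multiset.induction_on with
  | empty => simp [profile]
  | cons e E ih =>
    simp only [profile, Multiset.map_cons, Multiset.sum_cons, Pi.add_apply,
      Multiset.countP_cons] at ih ⊢
    rw [ih, Pi.single_apply]
    by_cases h : col e = c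
    · simp [h, add_comm]
    · simp [h, Ne.symm h]

lemma sum_profile (col : Sym2 V → Fin r) (E : Multiset (Sym2 V)) :
    ∑ c, profile col E c = E.card := by
  induction E using Multiset.induction_on with
  | empty => simp [profile]
  | cons e E ih =>
    simp only [profile, Multiset.map_cons, Multiset.sum_cons, Pi.add_apply,
      Finset.sum_add_distrib, Multiset.card_cons] at ih ⊢
    rw [ih, Finset.sum_pi_single']
    simp [add_comm]

lemma pathEdges_le_cons (a : V) (l : List V) : pathEdges l ≤ pathEdges (a :: l) := by
  cases l with
  | nil => simp [pathEdges]
  | cons b l => exact Multiset.le_cons_self _ _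

lemma pathEdges_le_cycleEdges (l : List V) : pathEdges l ≤ cycleEdges l := by
  rcases l with _ | ⟨a, l⟩
  · exact le_rfl
  · rcases List.eq_nil_or_concat l with rfl | ⟨m, z, rfl⟩
    · simp [pathEdges]
    · rw [List.concat_eq_append, cycleEdges_eq]
      exact Multiset.le_cons_self _ _

/-- Listing the outer vertices of a family of bowties one bowtie after the other gives a sequence
containing all outer edges of the family. -/
lemma outer_edges_le (B : List (Bowtie V)) (m : List V) :
    (B.map fun t => s(t.x, t.y) : Multiset (Sym2 V)) + (B.map fun t => s(t.p, t.q)) ≤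
      pathEdges (B.flatMap (fun t => [t.x, t.y, t.p, t.q]) ++ m) := by
  induction B with
  | nil => simp
  | cons t B ih =>
    simp only [List.map_cons, ← Multiset.cons_coe, List.flatMap_cons, List.cons_append,
      List.nil_append, pathEdges, Multiset.cons_add, Multiset.add_cons] at ih ⊢
    rw [Multiset.cons_swap]
    refine Multiset.cons_le_cons _ ((Multiset.cons_le_cons _ ?_).trans (Multiset.le_cons_self _ _))
    exact ih.trans (pathEdges_le_cons _ _)

lemma map_add_map_eq_ite {α β : Type*} (B : List β) (σ : β → Bool) (f g : β → α) :
    (B.map f : Multiset α) + (B.map g) =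
      (B.map fun t => if σ t then f t else g t) + (B.map fun t => if σ t then g t else f t) := by
  induction B with
  | nil => rfl
  | cons t B ih =>
    simp only [List.map_cons, ← Multiset.cons_coe, Multiset.cons_add, Multiset.add_cons, ih]
    cases σ t
    · simpa using List.Perm.swap _ _ _
    · simp

lemma profile_insertions (col : Sym2 V → Fin r) (I : List (V × V × V)) :
    profile col (I.map fun t => s(t.1, t.2.1)) + profile col (I.map fun t => s(t.1, t.2.2)) =
      profile col (I.map fun t => s(t.2.1, t.2.2)) +
        (I.map fun t => insertionVector col t.1 t.2.1 t.2.2).sum := by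
  induction I with
  | nil => simp [profile]
  | cons t I ih =>
    simp only [profile, List.map_cons, ← Multiset.cons_coe, Multiset.map_cons, Multiset.sum_cons,
      List.sum_cons] at ih ⊢
    rw [add_add_add_comm, ih, insertionVector]
    abel

/-- Disjoint unbalanced bowties are few if every Hamilton cycle has small colour bias. A
Hamilton cycle through all the outer edges of the family, and avoiding its centres, extends to a
Hamilton cycle of the graph by inserting each centre into either of its two outer edges. -/
theorem length_le_of_disjoint_unbalanced [Fintype V] [DecidableEq V] (hr : 0 < r)
    (G : SimpleGraph V) [DecidableRel G.Adj] (col : Sym2 V → Fin r) (b : ℝ) (hb : 0 ≤ b)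
    (hbias : ∀ l : List V, l.Nodup → (∀ v, v ∈ l) → 3 ≤ l.length →
      (∀ e ∈ cycleEdges l, e ∈ G.edgeSet) →
      ∀ c, ((profile col (cycleEdges l) c : ℤ) : ℝ) ≤ (Fintype.card V : ℝ) / r + b)
    (B : List (Bowtie V)) (hB : ∀ t ∈ B, t.IsIn G ∧ t.Unbalanced col)
    (hnd : (B.flatMap Bowtie.verts).Nodup)
    (hdeg : ∀ v, Fintype.card V + 3 * B.length ≤ 2 * G.degree v) :
    (B.length : ℝ) ≤ 2 * r * b := by
  classical
  rcases eq_or_ne B [] with rfl | hne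
  · simpa using by positivity
  have hpos : 1 ≤ B.length := List.length_pos_iff.2 hne
  have hBnd : B.Nodup := by
    refine (List.nodup_flatMap.1 hnd).2.imp fun {s t} hst => ?_
    rintro rfl
    exact hst (a := s.u) (by simp [Bowtie.verts]) (by simp [Bowtie.verts])
  set outer := B.flatMap fun t => [t.x, t.y, t.p, t.q] with houter
  set rest := (Finset.univ.filter fun v => v ∉ B.flatMap Bowtie.verts).toList with hrest
  set l₀ := outer ++ rest with hl₀
  have hperm₁ : (B.map (·.u) ++ l₀).Perm (B.flatMap Bowtie.verts ++ rest) := by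
    rw [hl₀, ← List.append_assoc]
    exact (List.map_append_flatMap_perm B (·.u) fun t => [t.x, t.y, t.p, t.q]).append_right rest
  have hperm : (B.map (·.u) ++ l₀).Perm (Finset.univ : Finset V).toList := by
    refine hperm₁.trans ((List.perm_ext_iff_of_nodup ?_ (Finset.nodup_toList _)).2 fun v => ?_)
    · refine List.nodup_append'.2 ⟨hnd, Finset.nodup_toList _, fun v hv hv' => ?_⟩
      exact (Finset.mem_filter.1 (Finset.mem_toList.1 hv')).2 hv
    · by_cases hv : v ∈ B.flatMap Bowtie.verts <;> simp [hrest, hv, -List.mem_flatMap]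
  have hnd₀ : (B.map (·.u) ++ l₀).Nodup := hperm.nodup_iff.2 (Finset.nodup_toList _)
  have hlen₀ : B.length + l₀.length = Fintype.card V := by
    have := hperm.length_eq
    simpa using this
  have hlen₄ : 4 * B.length ≤ l₀.length := by
    rw [hl₀, houter, List.length_append, List.length_flatMap]
    simp
    omega
  have hcount : ∀ v, G.degree v ≤ B.length + l₀.countP (G.Adj v) := by
    intro v
    have h₁ := hperm.countP_eq (fun w => decide (G.Adj v w))
    have h₂ : (Finset.univ : Finset V).toList.countP (fun w => decide (G.Adj v w)) =
        G.degree v := by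
      rw [← G.card_neighborFinset_eq_degree, G.neighborFinset_eq_filter,
        ← Multiset.coe_countP, Finset.coe_toList, Multiset.countP_eq_card_filter]
      simp [Finset.card_def]
    rw [List.countP_append, h₂] at h₁
    have h₃ := List.countP_le_length (p := fun w => decide (G.Adj v w)) (l := B.map (·.u))
    rw [List.length_map] at h₃
    omega
  set F : Multiset (Sym2 V) :=
    (B.map fun t => s(t.x, t.y) : Multiset (Sym2 V)) + (B.map fun t => s(t.p, t.q)) with hF
  -- There are `n - k` vertices of degree at least `δ - k` and `2 k` prescribed edges, so the degree
  -- condition reads `(n - k) + 2 k ≤ 2 (δ - k)`.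
  obtain ⟨l, hlp, hFl, hlG⟩ : ∃ l : List V, l.Perm l₀ ∧ F ≤ cycleEdges l ∧
      ∀ e ∈ cycleEdges l, e ∈ G.edgeSet := by
    refine exists_hamilton_list G F ?_ l₀ (List.nodup_append'.1 hnd₀).2.1 (by omega)
      ((outer_edges_le B rest).trans (pathEdges_le_cycleEdges _)) ?_
    · intro e he
      simp only [hF, Multiset.mem_add, Multiset.mem_coe, List.mem_map] at he
      rcases he with ⟨t, ht, rfl⟩ | ⟨t, ht, rfl⟩
      · exact (hB t ht).1.1.2.2
      · exact (hB t ht).1.2.2.2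
    · intro v _
      have := hdeg v
      have := hcount v
      simp only [hF, Multiset.card_add, Multiset.coe_card, List.length_map]
      omega
  obtain ⟨R, hR⟩ := Multiset.le_iff_exists_add.1 hFl
  -- `I σ` lists the insertions selected by `σ`, and `J σ` the outer edges that are kept.
  set I : (Bowtie V → Bool) → List (V × V × V) := fun σ =>
    B.map fun t => if σ t then (t.u, t.x, t.y) else (t.u, t.p, t.q) with hI
  set J : (Bowtie V → Bool) → Multiset (Sym2 V) := fun σ =>
    (B.map fun t => if σ t then s(t.p, t.q) else s(t.x, t.y) : List (Sym2 V)) with hJ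
  have hIJ : ∀ σ, cycleEdges l =
      ((I σ).map fun t => s(t.2.1, t.2.2) : Multiset (Sym2 V)) + (J σ + R) := by
    intro σ
    rw [hR, hF, map_add_map_eq_ite B σ, add_assoc, hI]
    congr 2
    rw [List.map_map]
    refine List.map_congr_left fun t _ => ?_
    cases h : σ t <;> simp [h]
  set g : Bowtie V → Fin r → ℤ := fun t => insertionVector col t.u t.x t.y with hg
  set h : Bowtie V → Fin r → ℤ := fun t => insertionVector col t.u t.p t.q with hh
  have hcycle : ∀ σ : Bowtie V → Bool, ∃ l' : List V, l'.Perm (Finset.univ : Finset V).toList ∧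
      (∀ e ∈ cycleEdges l', e ∈ G.edgeSet) ∧ profile col (cycleEdges l') =
        profile col (cycleEdges l) + ∑ t ∈ B.toFinset, if σ t then g t else h t := by
    intro σ
    obtain ⟨l', hp', hc'⟩ := exists_insert_list (I σ) (by rw [hlp.length_eq]; omega) _ (hIJ σ)
    have hu : (I σ).map (·.1) = B.map (·.u) := by
      rw [hI, List.map_map]
      refine List.map_congr_left fun t _ => ?_
      cases h : σ t <;> simp [h]
    refine ⟨l', (hp'.trans ?_).trans hperm, ?_, ?_⟩
    · rw [hu]; exact hlp.append_left _
    · intro e he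
      rw [hc', Multiset.mem_add, Multiset.mem_add] at he
      rcases he with (he | he) | he
      · simp only [hI, Multiset.mem_coe, List.map_map, List.mem_map, Function.comp_apply] at he
        obtain ⟨t, ht, rfl⟩ := he
        cases σ t
        · exact (hB t ht).1.2.1
        · exact (hB t ht).1.1.1
      · simp only [hI, Multiset.mem_coe, List.map_map, List.mem_map, Function.comp_apply] at he
        obtain ⟨t, ht, rfl⟩ := he
        cases σ t
        · exact (hB t ht).1.2.2.1
        · exact (hB t ht).1.1.2.1
      · exact hlG e (by rw [hIJ σ]; exact Multiset.mem_add.2 (Or.inr he))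
    · have hs : ((I σ).map fun t => insertionVector col t.1 t.2.1 t.2.2).sum =
          ∑ t ∈ B.toFinset, if σ t then g t else h t := by
        rw [List.sum_toFinset _ hBnd, hI, List.map_map]
        refine congrArg _ (List.map_congr_left fun t _ => ?_)
        cases h : σ t <;> simp [h, hg, hh]
      rw [hc', profile_add, profile_add, profile_insertions, hs, hIJ σ]
      simp only [profile_add]
      abel
  rw [← List.toFinset_card_of_nodup hBnd]
  refine card_le_of_all_choices hr B.toFinset g h
    (fun t ht => (hB t (List.mem_toFinset.1 ht)).2) (profile col (cycleEdges l))
    (Fintype.card V) b ?_ ?_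
  · intro σ
    obtain ⟨l', hp', -, hl'⟩ := hcycle σ
    rw [← hl', sum_profile, card_cycleEdges, hp'.length_eq, Finset.length_toList, Finset.card_univ]
    simp
  · intro σ c
    obtain ⟨l', hp', hG', hl'⟩ := hcycle σ
    rw [← hl']
    refine hbias l' (hp'.nodup_iff.2 (Finset.nodup_toList _))
      (fun v => hp'.mem_iff.2 (by simp)) ?_ hG' c
    rw [hp'.length_eq, Finset.length_toList, Finset.card_univ]
    omega

end Bowties

/-! ### Graphs without unbalanced bowties -/

section Structure

variable {V : Type*} {r : ℕ}

lemma insertionVector_add_insertionVector (col : Sym2 V → Fin r) (u x y : V) (c : Fin r) :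
    insertionVector col u x y c + insertionVector col x u y c =
      2 * (Pi.single (col s(u, x)) 1 : Fin r → ℤ) c := by
  simp only [insertionVector, Sym2.eq_swap (a := x) (b := u), Pi.add_apply, Pi.sub_apply]
  ring

variable [DecidableEq V]

/-- If no bowtie outside `X` is unbalanced, the insertion vector of a triangle `u x y` depends on
`u` only: two triangles at `u` are compared through a third one meeting both only in `u`. -/
lemma insertionVector_eq (G : SimpleGraph V) (col : Sym2 V → Fin r) (X : Finset V)
    (hX : ∀ t : Bowtie V, t.IsIn G → t.verts.Nodup → (∀ v ∈ t.verts, v ∉ X) → ¬ t.Unbalanced col)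
    (hcn : ∀ (u v : V) (Y : Finset V), Y.card ≤ 4 → ∃ w, G.Adj u w ∧ G.Adj v w ∧ w ∉ X ∧ w ∉ Y)
    {u x y x' y' : V} (hu : u ∉ X) (hx : x ∉ X) (hy : y ∉ X) (hx' : x' ∉ X) (hy' : y' ∉ X)
    (h₁ : G.Adj u x ∧ G.Adj u y ∧ G.Adj x y) (h₂ : G.Adj u x' ∧ G.Adj u y' ∧ G.Adj x' y') :
    insertionVector col u x y = insertionVector col u x' y' := by
  obtain ⟨p, hup, -, hpX, hpY⟩ := hcn u u {x, y, x', y'} Finset.card_le_four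
  obtain ⟨q, huq, hpq, hqX, hqY⟩ := hcn u p {x, y, x', y'} Finset.card_le_four
  simp only [Finset.mem_insert, Finset.mem_singleton, not_or] at hpY hqY
  have key : ∀ a b, a ∉ X → b ∉ X → (G.Adj u a ∧ G.Adj u b ∧ G.Adj a b) → p ≠ a → p ≠ b →
      q ≠ a → q ≠ b → insertionVector col u a b = insertionVector col u p q := by
    intro a b ha hb hab hpa hpb hqa hqb
    have := hX ⟨u, a, b, p, q⟩ ⟨hab, hup, huq, hpq⟩
      (by simp [Bowtie.verts, hab.1.ne, hab.2.1.ne, hab.2.2.ne, hup.ne, huq.ne, hpq.ne, hpa.symm,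
            hpb.symm, hqa.symm, hqb.symm])
      (by simp [Bowtie.verts, hu, ha, hb, hpX, hqX])
    simpa [Bowtie.Unbalanced] using this
  rw [key x y hx hy h₁ hpY.1 hpY.2.1 hqY.1 hqY.2.1,
    key x' y' hx' hy' h₂ hpY.2.2.1 hpY.2.2.2 hqY.2.2.1 hqY.2.2.2]

/-- Outside the exceptional set `X` there are a colour `c` and an independent set `W` such that all
edges avoiding `W` have colour `c`. The insertion vectors `f u` satisfy `f u + f x = 2 e` for every
edge `ux`, where `e` is the unit vector of its colour, so their parities are constant and there is a
colour `c` in which all of them are odd; `W` consists of the vertices at which this coordinate is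
negative. -/
theorem exists_independent_set (G : SimpleGraph V) (col : Sym2 V → Fin r) (X : Finset V)
    (hX : ∀ t : Bowtie V, t.IsIn G → t.verts.Nodup → (∀ v ∈ t.verts, v ∉ X) → ¬ t.Unbalanced col)
    (hcn : ∀ (u v : V) (Y : Finset V), Y.card ≤ 4 → ∃ w, G.Adj u w ∧ G.Adj v w ∧ w ∉ X ∧ w ∉ Y)
    [Nonempty V] :
    ∃ (c : Fin r) (W : Set V), (∀ u ∈ W, ∀ v ∈ W, ¬ G.Adj u v) ∧
      ∀ u v, u ∉ X → v ∉ X → u ∉ W → v ∉ W → G.Adj u v → col s(u, v) = c := by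
  have hf : ∀ u, ∃ f : Fin r → ℤ, ∀ x y, u ∉ X → x ∉ X → y ∉ X → G.Adj u x → G.Adj u y →
      G.Adj x y → insertionVector col u x y = f := by
    intro u
    by_cases h : ∃ x y, x ∉ X ∧ y ∉ X ∧ G.Adj u x ∧ G.Adj u y ∧ G.Adj x y
    · obtain ⟨x', y', hx', hy', h'⟩ := h
      exact ⟨insertionVector col u x' y', fun x y hu hx hy h₁ h₂ h₃ =>
        insertionVector_eq G col X hX hcn hu hx hy hx' hy' ⟨h₁, h₂, h₃⟩ h'⟩
    · exact ⟨0, fun x y _ hx hy h₁ h₂ h₃ => absurd ⟨x, y, hx, hy, h₁, h₂, h₃⟩ h⟩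
  choose f hf using hf
  have hedge : ∀ u x, u ∉ X → x ∉ X → G.Adj u x → ∀ c,
      f u c + f x c = 2 * (Pi.single (col s(u, x)) 1 : Fin r → ℤ) c := by
    intro u x hu hx hux c
    obtain ⟨y, huy, hxy, hy, -⟩ := hcn u x ∅ (by simp)
    rw [← hf u x y hu hx hy hux huy hxy, ← hf x u y hx hu hy hux.symm hxy huy]
    exact insertionVector_add_insertionVector col u x y c
  obtain ⟨v⟩ := ‹Nonempty V›
  obtain ⟨v₀, -, -, hv₀, -⟩ := hcn v v ∅ (by simp)
  have hsum : ∑ c, f v₀ c = 1 := by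
    obtain ⟨x, hx, -, hxX, -⟩ := hcn v₀ v₀ ∅ (by simp)
    obtain ⟨y, hy, hxy, hyX, -⟩ := hcn v₀ x ∅ (by simp)
    rw [← hf v₀ x y hv₀ hxX hyX hx hy hxy]
    simp [insertionVector, Finset.sum_add_distrib, Finset.sum_sub_distrib, Finset.sum_pi_single']
  obtain ⟨c, hc⟩ : ∃ c, Odd (f v₀ c) := by
    by_contra hno
    push Not at hno
    have : Even (∑ c, f v₀ c) := Finset.even_sum _ fun c _ => Int.not_odd_iff_even.1 (hno c)
    rw [hsum] at this
    exact absurd this (by decide)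
  have hodd : ∀ v, v ∉ X → Odd (f v c) := by
    intro v hv
    obtain ⟨w, h₁, h₂, hw, -⟩ := hcn v₀ v ∅ (by simp)
    have e₁ := hedge v₀ w hv₀ hw h₁ c
    have e₂ := hedge v w hv hw h₂ c
    obtain ⟨k, hk⟩ := hc
    exact ⟨k + (Pi.single (col s(v, w)) 1 : Fin r → ℤ) c -
      (Pi.single (col s(v₀, w)) 1 : Fin r → ℤ) c, by linarith⟩
  refine ⟨c, {v | v ∉ X ∧ f v c < 0}, ?_, ?_⟩
  · rintro u ⟨hu, hu'⟩ v ⟨hv, hv'⟩ huv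
    have := hedge u v hu hv huv c
    rw [Pi.single_apply] at this
    split_ifs at this <;> omega
  · intro u v hu hv hu' hv' huv
    have h₁ := hedge u v hu hv huv c
    obtain ⟨k, hk⟩ := hodd u hu
    have hu₀ : ¬ f u c < 0 := fun h => hu' ⟨hu, h⟩
    have hv₀ : ¬ f v c < 0 := fun h => hv' ⟨hv, h⟩
    rw [Pi.single_apply] at h₁
    split_ifs at h₁ with h
    · exact h.symm
    · omega

end Structure

/-! ### Matchings, colour counts and maximal families of bowties -/

section Main

variable {V : Type*}

/-- A matching each of whose edges meets `X` has at most `|X|` edges. -/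
lemma ncard_edgeSet_le_of_isMatching {G : SimpleGraph V} {M : G.Subgraph} (hM : M.IsMatching)
    (X : Finset V) (h : ∀ e ∈ M.edgeSet, ∃ x ∈ X, x ∈ e) : M.edgeSet.ncard ≤ X.card := by
  rcases M.edgeSet.eq_empty_or_nonempty with h₀ | ⟨e₀, he₀⟩
  · simp [h₀]
  have : Nonempty V := ⟨(h e₀ he₀).choose⟩
  choose! f hfX hfe using h
  rw [← Set.ncard_coe_finset X]
  refine Set.ncard_le_ncard_of_injOn f (fun e he => hfX e he) ?_ X.finite_toSet
  intro e he e' he' hee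
  obtain ⟨w, hw⟩ := hfe e he
  obtain ⟨w', hw'⟩ := hfe e' he'
  rw [← hee] at hw'
  rw [hw, SimpleGraph.Subgraph.mem_edgeSet] at he
  rw [hw', SimpleGraph.Subgraph.mem_edgeSet] at he'
  rw [hw, hw', hM.eq_of_adj_left he he']

/-- The number of edges of a given colour on a cycle is a coordinate of its profile. -/
lemma colourCount_eq_profile [DecidableEq V] {G : SimpleGraph V} {r : ℕ}
    (χ : G.EdgeLabeling (Fin r)) (col : Sym2 V → Fin r)
    (hcol : ∀ e : G.edgeSet, col e = χ e) {v : V} (p : G.Walk v v) (hp : p.edges.Nodup)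
    (c : Fin r) : (colourCount χ p c : ℤ) = profile col p.edges c := by
  rw [profile_apply, colourCount, ← Set.ncard_image_of_injective _ Subtype.val_injective]
  have : Subtype.val '' {e : G.edgeSet | (e : Sym2 V) ∈ p.edges ∧ χ e = c} =
      ((p.edges.toFinset.filter fun e => col e = c : Finset (Sym2 V)) : Set (Sym2 V)) := by
    ext e
    simp only [Set.mem_image, Set.mem_ofPred_eq, Finset.coe_filter, List.mem_toFinset]
    constructor
    · rintro ⟨e, ⟨h₁, h₂⟩, rfl⟩
      exact ⟨h₁, by rw [hcol, h₂]⟩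
    · rintro ⟨h₁, h₂⟩
      have he := p.edges_subset_edgeSet h₁
      exact ⟨⟨e, he⟩, ⟨h₁, by rw [← hcol ⟨e, he⟩, h₂]⟩, rfl⟩
  rw [this, Set.ncard_coe_finset, Multiset.countP_eq_card_filter, Finset.card_def,
    Finset.filter_val, List.toFinset_val, hp.dedup]

/-- If disjoint families of unbalanced bowties never have size `K`, then fewer than `K` disjoint
bowties meet every unbalanced bowtie. -/
lemma exists_maximal_family [DecidableEq V] {r : ℕ} (G : SimpleGraph V) (col : Sym2 V → Fin r)
    (K : ℕ)
    (hK : ∀ B : List (Bowtie V), (∀ t ∈ B, t.IsIn G ∧ t.Unbalanced col) →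
      (B.flatMap Bowtie.verts).Nodup → B.length ≠ K) :
    ∃ B : List (Bowtie V), B.length < K ∧ (B.flatMap Bowtie.verts).Nodup ∧
      ∀ t : Bowtie V, t.IsIn G → t.verts.Nodup → (∀ v ∈ t.verts, v ∉ B.flatMap Bowtie.verts) →
        ¬ t.Unbalanced col := by
  by_contra hno
  push Not at hno
  have : ∀ k ≤ K, ∃ B : List (Bowtie V), (∀ t ∈ B, t.IsIn G ∧ t.Unbalanced col) ∧
      (B.flatMap Bowtie.verts).Nodup ∧ B.length = k := by
    intro k
    induction k with
    | zero => exact fun _ => ⟨[], by simp⟩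
    | succ k ih =>
      intro hk
      obtain ⟨B, hB, hnd, rfl⟩ := ih (by omega)
      obtain ⟨t, ht, htn, htB, htu⟩ := hno B (by omega) hnd
      refine ⟨t :: B, ?_, ?_, rfl⟩
      · intro s hs
        rcases List.mem_cons.1 hs with rfl | hs
        · exact ⟨ht, htu⟩
        · exact hB s hs
      · rw [List.flatMap_cons]
        exact List.nodup_append'.2 ⟨htn, hnd, fun v hv hv' => htB v hv hv'⟩
  obtain ⟨B, hB, hnd, hlen⟩ := this K le_rfl
  exact hK B hB hnd hlen

end Main

end ColourBias

open ColourBias in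
theorem proposition4p1 (r : ℕ) (hr : 2 ≤ r) :
    ∃ n₀ : ℕ, ∀ n : ℕ, n₀ ≤ n →
      ∀ b : ℝ, 1 ≤ b → b ≤ (n : ℝ) / (2 ^ 10 * (r : ℝ) ^ 2) →
      ∀ (V : Type*) [Fintype V] [DecidableEq V] (G : SimpleGraph V) [DecidableRel G.Adj],
        Fintype.card V = n →
        criticalDensity r * (n : ℝ) ≤ (G.minDegree : ℝ) →
        ∀ χ : G.EdgeLabeling (Fin r),
          (∀ (v : V) (p : G.Walk v v), p.IsHamiltonianCycle → colourBias χ p ≤ b) →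
          ∃ (U : Finset V) (c : Fin r),
            U.card = ⌈criticalDensity r * (n : ℝ)⌉₊ ∧
            ∀ M : G.Subgraph, IsMatchingInside M U → AvoidsColour χ M c →
              (M.edgeSet.ncard : ℝ) < 2 ^ 9 * (r : ℝ) * b := by
  -- The bound `n ≥ 2 ^ 10 * r ^ 2` needed below follows from the two bounds on `b`.
  refine ⟨0, fun n _ b hb₁ hb₂ V _ _ G _ hn hδ χ hχ => ?_⟩
  classical
  subst hn
  set n := Fintype.card V with hn
  have hr₀ : 0 < r := by omega
  have hr₂ : (2 : ℝ) ≤ r := by exact_mod_cast hr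
  have hrb : 2 ≤ r * b := by nlinarith
  have hnr : 1024 * (r * b) ≤ (n : ℝ) / r := by
    rw [le_div_iff₀ (by positivity)] at hb₂ ⊢
    nlinarith
  have hδ' : (n : ℝ) + n / r ≤ 2 * G.minDegree := by
    have : criticalDensity r * n = (n + n / r) / 2 := by
      unfold criticalDensity; field_simp
    linarith
  set col : Sym2 V → Fin r := fun e => if h : e ∈ G.edgeSet then χ ⟨e, h⟩ else ⟨0, hr₀⟩ with hcol
  have hcol' : ∀ e : G.edgeSet, col e = χ e := fun e => by simp [hcol]
  have hbias : ∀ l : List V, l.Nodup → (∀ v, v ∈ l) → 3 ≤ l.length →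
      (∀ e ∈ cycleEdges l, e ∈ G.edgeSet) →
      ∀ c, ((profile col (cycleEdges l) c : ℤ) : ℝ) ≤ (n : ℝ) / r + b := by
    intro l hl huniv hlen hG c
    obtain ⟨v, p, hp, hpe⟩ := exists_isHamiltonianCycle G l hl huniv hlen hG
    rw [← hpe, ← colourCount_eq_profile χ col hcol' p hp.isCycle.edges_nodup c]
    have h₁ : (colourCount χ p c : ℝ) ≤ ⨆ c : Fin r, (colourCount χ p c : ℝ) :=
      le_ciSup (f := fun c : Fin r => (colourCount χ p c : ℝ)) (Set.finite_range _).bddAbove c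
    have h₂ := hχ v p hp
    rw [colourBias] at h₂
    push_cast
    linarith
  obtain ⟨B, hBlen, hBnd, hBmax⟩ := exists_maximal_family G col (⌊2 * r * b⌋₊ + 1) (by
    intro B hB hnd hlen
    have hfloor : ((⌊2 * r * b⌋₊ : ℕ) : ℝ) ≤ 2 * r * b := Nat.floor_le (by positivity)
    have h₁ := length_le_of_disjoint_unbalanced hr₀ G col b (by linarith) hbias B hB hnd (by
      intro v
      have h₂ : (G.minDegree : ℝ) ≤ G.degree v := by exact_mod_cast G.minDegree_le_degree v
      rw [hlen]
      have : (n : ℝ) + 3 * (⌊2 * r * b⌋₊ + 1) ≤ 2 * G.degree v := by linarith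
      exact_mod_cast this)
    rw [hlen] at h₁
    have := Nat.lt_floor_add_one (2 * (r : ℝ) * b)
    push_cast at h₁
    linarith)
  set X : Finset V := (B.flatMap Bowtie.verts).toFinset with hX
  have hXcard : (X.card : ℝ) ≤ 10 * (r * b) := by
    have h₁ : X.card = 5 * B.length := by
      rw [hX, List.toFinset_card_of_nodup hBnd, List.length_flatMap]
      simp [Bowtie.verts, mul_comm]
    have h₂ : (B.length : ℝ) ≤ 2 * r * b := by
      refine le_trans ?_ (Nat.floor_le (by positivity : (0 : ℝ) ≤ 2 * r * b))
      exact_mod_cast Nat.lt_succ_iff.1 hBlen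
    rw [h₁]
    push_cast
    linarith
  have hcn : ∀ (u v : V) (Y : Finset V), Y.card ≤ 4 →
      ∃ w, G.Adj u w ∧ G.Adj v w ∧ w ∉ X ∧ w ∉ Y := by
    intro u v Y hY
    have h₁ : ¬ G.neighborFinset u ∩ G.neighborFinset v ⊆ X ∪ Y := by
      intro hsub
      have h₂ := (Finset.card_le_card hsub).trans (Finset.card_union_le X Y)
      have h₃ := Finset.card_union_add_card_inter (G.neighborFinset u) (G.neighborFinset v)
      have h₄ := Finset.card_le_univ (G.neighborFinset u ∪ G.neighborFinset v)
      rw [G.card_neighborFinset_eq_degree, G.card_neighborFinset_eq_degree] at h₃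
      have h₅ := G.minDegree_le_degree u
      have h₆ := G.minDegree_le_degree v
      have h₇ : 2 * G.minDegree ≤ n + (X.card + 4) := by omega
      have h₈ : (2 : ℝ) * G.minDegree ≤ n + (X.card + 4) := by exact_mod_cast h₇
      linarith
    obtain ⟨w, hw, hw'⟩ := Finset.not_subset.1 h₁
    simp only [Finset.mem_inter, SimpleGraph.mem_neighborFinset] at hw
    simp only [Finset.mem_union, not_or] at hw'
    exact ⟨w, hw.1, hw.2, hw'.1, hw'.2⟩
  have hne : Nonempty V := by
    rw [← Fintype.card_pos_iff, ← hn]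
    refine Nat.pos_of_ne_zero fun h => ?_
    rw [h] at hnr
    simp at hnr
    linarith
  obtain ⟨c, W, hW, hWc⟩ := exists_independent_set G col X
    (fun t ht htn htX => hBmax t ht htn fun v hv => by
      simpa only [hX, List.mem_toFinset] using htX v hv) hcn
  have hlarge : ⌈criticalDensity r * (n : ℝ)⌉₊ ≤
      (Finset.univ.filter fun v => v ∉ W).card := by
    refine (Nat.ceil_le.2 hδ).trans ?_
    by_cases h : ∃ w, w ∈ W
    · obtain ⟨w, hw⟩ := h
      refine (G.minDegree_le_degree w).trans ?_
      rw [← G.card_neighborFinset_eq_degree]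
      refine Finset.card_le_card fun v hv => ?_
      rw [SimpleGraph.mem_neighborFinset] at hv
      simpa using fun hvW => hW w hw v hvW hv
    · push Not at h
      obtain ⟨v⟩ := hne
      simp only [h, not_false_eq_true, Finset.filter_true, Finset.card_univ]
      exact (G.minDegree_le_degree v).trans (G.degree_lt_card_verts v).le
  obtain ⟨U, hUW, hU⟩ := Finset.exists_subset_card_eq hlarge
  refine ⟨U, c, hU, fun M hM hMc => ?_⟩
  have hle := ncard_edgeSet_le_of_isMatching hM.1 X (by
    intro e he
    induction e using Sym2.ind with
    | _ u v =>
    by_contra hno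
    push Not at hno
    have huv : M.Adj u v := he
    have hu := (Finset.mem_filter.1 (hUW (hM.2 huv.fst_mem))).2
    have hv := (Finset.mem_filter.1 (hUW (hM.2 huv.snd_mem))).2
    have huX : u ∉ X := fun h => hno u h (Sym2.mem_mk_left u v)
    have hvX : v ∉ X := fun h => hno v h (Sym2.mem_mk_right u v)
    have h₁ := hWc u v huX hvX hu hv huv.adj_sub
    exact hMc ⟨s(u, v), huv.adj_sub⟩ he ((hcol' ⟨s(u, v), huv.adj_sub⟩).symm.trans h₁))
  have hle' : (M.edgeSet.ncard : ℝ) ≤ X.card := by exact_mod_cast hle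
  linarith
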